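/- Let $e_{a,b}$ ($1\le a,b\le N$) be the standard generators of the Lie algebra $\mathfrak{gl}_N$ over $\mathbb C$. Let $V_1,\dots,V_n$ be Verma modules over $\mathfrak{gl}_N$ with highest weights $\Lambda^1,\dots,\Lambda^n\in\mathbb C^N$ and highest weight vectors $v_1,\dots,v_n$, where $e_{a,b}v_i=0$ for $a<b$ and $e_{a,a}v_i=\Lambda^i_a v_i$. Let $p$ be a nonzero complex number. **R-matrices.** For two Verma modules $V,W$ with highest weight vectors $v,w$ and $x\in\mathbb C$, a normalized intertwining isomorphism is a linear bijection $R$ of $V\otimes W$ such that $R(v\otimes w)=v\otimes w$ and, for all $a,b=1,\dots,N$, $$[R,\ e_{a,b}\otimes 1+1\otimes e_{a,b}]=0,$$ $$R\Bigl(x\,1\otimes e_{a,b}-\sum_{c=1}^N e_{a,c}\otimes e_{c,b}\Bigr)=\Bigl(x\,1\otimes e_{a,b}-\sum_{c=1}^N e_{c,b}\otimes e_{a,c}\Bigr)R .$$ The point $x$ is called generic for $(V,W)$ if there is exactly one such $R$; it is then denoted $R_{V,W}(x)$ (the rational R-matrix at $x$). The superscripts ${}^{(i)}$ and ${}^{(i,j)}$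 indicate the factors of $V_1\otimes\dots\otimes V_n$ on which an operator acts, and $e_{a,b}=\sum_i e_{a,b}^{(i)}$ on $V_1\otimes\dots\otimes V_n$. **Operators.** Let $O\subset\mathbb C^N$ be an open set of points $\lambda=(\lambda_1,\dots,\lambda_N)$ with nonzero coordinates, on which continuous branches of $\log\lambda_1,\dots,\log\lambda_N$ are fixed; $\lambda_a^{e_{a,a}}$ multiplies a weight vector of weight $\mu$ by $\exp(\mu_a\log\lambda_a)$. For $m=1,\dots,n$ and $a=1,\dots,N$ put $$K_m(z;\lambda)=\bigl(R^{(1,m)}_{V_1,V_m}(z_1-z_m-p)\cdots R^{(m-1,m)}_{V_{m-1},V_m}(z_{m-1}-z_m-p)\bigr)^{-1}\prod_{a=1}^N\lambda_a^{e_{a,a}^{(m)}}\;R^{(m,n)}_{V_m,V_n}(z_m-z_n)\cdots R^{(m,m+1)}_{V_m,V_{m+1}}(z_m-z_{m+1}),$$ $$L_a(z;\lambda)=\frac{(e_{a,a})^2}{2}-\sum_{i=1}^n z_i e_{a,a}^{(i)}-\sum_{b=1}^N\sum_{1\le i<j\le n}e_{a,b}^{(i)}e_{b,a}^{(j)}-\sum_{b\ne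 a}\frac{\lambda_b}{\lambda_a-\lambda_b}\,(e_{a,b}e_{b,a}-e_{a,a}),$$ and define the qKZ and dynamical operators on $V_1\otimes\dots\otimes V_n$-valued functions $f(z,\lambda)$ by $$(Z_mf)(z,\lambda)=K_m(z;\lambda)^{-1}f(z_1,\dots,z_m+p,\dots,z_n,\lambda),\qquad D_a=p\,\lambda_a\frac{\partial}{\partial\lambda_a}+L_a(z;\lambda).$$ A function of one complex variable with values in the vector space $V_1\otimes\dots\otimes V_n$ is called differentiable at a point if near that point it takes values in a finite-dimensional subspace and is complex differentiable there at that point. **Theorem.** The qKZ operators $Z_1,\dots,Z_n$ commute with the dynamical operators $D_1,\dots,D_N$. Precisely, let $1\le m\le n$, $1\le a\le N$, let $\lambda\in O$ satisfy $\lambda_b\ne\lambda_a$ for all $b\neq a$, and let $z\in\mathbb C^n$ be such that $z_l-z_m-p$ is generic for $(V_l,V_m)$ for every $l<m$ and $z_m-z_l$ is generic for $(V_m,V_l)$ for every $l>m$. Then $K_m(z;\lambda)$ is invertible, and for every function $f$ such that $f(z_1,\dots,z_m+p,\dots,z_n,\,\cdot\,)$ has a partial derivative with respect to $\lambda_a$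 at $\lambda$, the function $(Z_mf)(z,\,\cdot\,)$ has a partial derivative with respect to $\lambda_a$ at $\lambda$, and $$(Z_mD_af)(z,\lambda)=(D_aZ_mf)(z,\lambda).$$ -/

import Mathlib

open scoped TensorProduct Topology

noncomputable section

namespace QKZ

attribute [local instance 100] LieRing.ofAssociativeRing

/-! ### `U(gl_N)` and Verma modules -/

/-- The universal enveloping algebra of the complex Lie algebra `gl_N`. -/
abbrev U (N : ℕ) : Type :=
  UniversalEnvelopingAlgebra ℂ (Matrix (Fin N) (Fin N) ℂ)

/-- The standard generators `e_{a,b}`, so that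
`[e_{a,b}, e_{c,d}] = δ_{b,c} e_{a,d} - δ_{a,d} e_{c,b}`. -/
def e {N : ℕ} (a b : Fin N) : U N :=
  UniversalEnvelopingAlgebra.ι ℂ (Matrix.single a b (1 : ℂ))

/-- The left ideal of `U(gl_N)` generated by `e_{a,b}` for `a < b` and by `e_{a,a} - Λ_a`. -/
def vermaIdeal {N : ℕ} (Λ : Fin N → ℂ) : Submodule (U N) (U N) :=
  Submodule.span (U N)
    ({u | ∃ a b : Fin N, a < b ∧ u = e a b} ∪
      {u | ∃ a : Fin N, u = e a a - algebraMap ℂ (U N) (Λ a)})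

/-- The Verma module over `gl_N` with highest weight `Λ`. -/
def Verma {N : ℕ} (Λ : Fin N → ℂ) : Type := U N ⧸ vermaIdeal Λ

instance {N : ℕ} (Λ : Fin N → ℂ) : AddCommGroup (Verma Λ) :=
  inferInstanceAs (AddCommGroup (U N ⧸ vermaIdeal Λ))

instance {N : ℕ} (Λ : Fin N → ℂ) : Module (U N) (Verma Λ) :=
  inferInstanceAs (Module (U N) (U N ⧸ vermaIdeal Λ))

instance {N : ℕ} (Λ : Fin N → ℂ) : Module ℂ (Verma Λ) :=
  inferInstanceAs (Module ℂ (U N ⧸ vermaIdeal Λ))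

instance {N : ℕ} (Λ : Fin N → ℂ) : IsScalarTower ℂ (U N) (Verma Λ) :=
  inferInstanceAs (IsScalarTower ℂ (U N) (U N ⧸ vermaIdeal Λ))

/-- The highest weight vector of the Verma module. -/
def hwv {N : ℕ} (Λ : Fin N → ℂ) : Verma Λ :=
  (Submodule.Quotient.mk 1 : U N ⧸ vermaIdeal Λ)

/-- The action of `e_{a,b}` on the Verma module. -/
def act {N : ℕ} (Λ : Fin N → ℂ) (a b : Fin N) : Module.End ℂ (Verma Λ) :=
  Algebra.lsmul ℂ ℂ (Verma Λ) (e a b)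

open Classical in
/-- The operator `∏_a λ_a ^ e_{a,a}` on a Verma module, where `ell a` is the chosen value of
`log λ_a`: it multiplies a vector of weight `μ` by `∏_a λ_a ^ μ_a = exp (∑_a ell_a μ_a)`.
As a Verma module is spanned by its weight vectors, this property determines the operator. -/
def torus {N : ℕ} (Λ : Fin N → ℂ) (ell : Fin N → ℂ) : Module.End ℂ (Verma Λ) :=
  if h : ∃ A : Module.End ℂ (Verma Λ), ∀ (μ : Fin N → ℂ) (w : Verma Λ),
      (∀ a, act Λ a a w = μ a • w) → A w = Complex.exp (∑ a, ell a * μ a) • w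
  then h.choose else 0

/-! ### The rational R-matrix -/

/-- `R` is a linear automorphism of `V₁ ⊗ V₂` which is a normalized intertwiner with spectral
parameter `x`, that is, `P R : V₁(x) ⊗ V₂(0) → V₂(0) ⊗ V₁(x)` is an isomorphism of Yangian
modules sending `v₁ ⊗ v₂` to `v₂ ⊗ v₁`. -/
structure IsRMatrix {N : ℕ} (Λ₁ Λ₂ : Fin N → ℂ) (x : ℂ)
    (R : Module.End ℂ (Verma Λ₁ ⊗[ℂ] Verma Λ₂)) : Prop where
  bijective : Function.Bijective R
  normalized : R (hwv Λ₁ ⊗ₜ[ℂ] hwv Λ₂) = hwv Λ₁ ⊗ₜ[ℂ] hwv Λ₂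
  commute : ∀ a b : Fin N,
    R * (TensorProduct.map (act Λ₁ a b) 1 + TensorProduct.map 1 (act Λ₂ a b)) =
      (TensorProduct.map (act Λ₁ a b) 1 + TensorProduct.map 1 (act Λ₂ a b)) * R
  intertwine : ∀ a b : Fin N,
    R * (x • TensorProduct.map 1 (act Λ₂ a b) -
        ∑ c, TensorProduct.map (act Λ₁ a c) (act Λ₂ c b)) =
      (x • TensorProduct.map 1 (act Λ₂ a b) -
        ∑ c, TensorProduct.map (act Λ₁ c b) (act Λ₂ a c)) * R

/-- `x` is a point at which the normalized intertwining isomorphism is well defined. -/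
def IsGeneric {N : ℕ} (Λ₁ Λ₂ : Fin N → ℂ) (x : ℂ) : Prop :=
  ∃! R : Module.End ℂ (Verma Λ₁ ⊗[ℂ] Verma Λ₂), IsRMatrix Λ₁ Λ₂ x R

open Classical in
/-- The rational R-matrix `R_{V₁,V₂}(x)` at a generic point `x` (and `0` elsewhere). -/
def rMatrix {N : ℕ} (Λ₁ Λ₂ : Fin N → ℂ) (x : ℂ) :
    Module.End ℂ (Verma Λ₁ ⊗[ℂ] Verma Λ₂) :=
  if h : IsGeneric Λ₁ Λ₂ x then h.choose else 0

/-! ### Operators acting on some factors of a tensor product -/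

section Factors

variable {n : ℕ} {V : Fin n → Type} [∀ i, AddCommGroup (V i)] [∀ i, Module ℂ (V i)]

/-- `A^{(i)}`: the operator `A` acting on the `i`-th factor of `V_1 ⊗ … ⊗ V_n`. -/
def site (i : Fin n) (A : Module.End ℂ (V i)) : Module.End ℂ (⨂[ℂ] k, V k) :=
  PiTensorProduct.map (Function.update (fun k => (LinearMap.id : V k →ₗ[ℂ] V k)) i A)

/-- For `i ≠ j` and fixed vectors `v_k`, the map `V_i ⊗ V_j → V_1 ⊗ … ⊗ V_n` which puts `x ⊗ y`
into the factors `i` and `j` of `v_1 ⊗ … ⊗ v_n`. -/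
def place {i j : Fin n} (hij : i ≠ j) (v : ∀ k, V k) :
    V i ⊗[ℂ] V j →ₗ[ℂ] ⨂[ℂ] k, V k :=
  TensorProduct.lift <| LinearMap.mk₂ ℂ
    (fun x y => PiTensorProduct.tprod ℂ (Function.update (Function.update v i x) j y))
    (fun x x' y => by
      simp only [Function.update_comm hij, MultilinearMap.map_update_add])
    (fun c x y => by
      simp only [Function.update_comm hij, MultilinearMap.map_update_smul])
    (fun x y y' => by simp only [MultilinearMap.map_update_add])
    (fun c x y => by simp only [MultilinearMap.map_update_smul])

theorem place_tmul {i j : Fin n} (hij : i ≠ j) (v : ∀ k, V k) (x : V i) (y : V j) :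
    place hij v (x ⊗ₜ[ℂ] y) =
      PiTensorProduct.tprod ℂ (Function.update (Function.update v i x) j y) := by
  simp [place]

theorem place_update_left {i j : Fin n} (hij : i ≠ j) (v : ∀ k, V k) (x : V i) :
    place hij (Function.update v i x) = place hij v := by
  apply TensorProduct.ext'
  intro y z
  simp [place_tmul]

theorem place_update_right {i j : Fin n} (hij : i ≠ j) (v : ∀ k, V k) (x : V j) :
    place hij (Function.update v j x) = place hij v := by
  apply TensorProduct.ext'
  intro y z
  simp only [place_tmul, Function.update_comm hij, Function.update_idem]

theorem place_update_add {i j k : Fin n} (hij : i ≠ j) (hi : k ≠ i) (hj : k ≠ j)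
    (v : ∀ k, V k) (x y : V k) :
    place hij (Function.update v k (x + y)) =
      place hij (Function.update v k x) + place hij (Function.update v k y) := by
  apply TensorProduct.ext'
  intro s t
  simp only [place_tmul, LinearMap.add_apply, Function.update_comm hi, Function.update_comm hj,
    MultilinearMap.map_update_add]

theorem place_update_smul {i j k : Fin n} (hij : i ≠ j) (hi : k ≠ i) (hj : k ≠ j)
    (v : ∀ k, V k) (c : ℂ) (x : V k) :
    place hij (Function.update v k (c • x)) = c • place hij (Function.update v k x) := by
  apply TensorProduct.ext'
  intro s t
  simp only [place_tmul, LinearMap.smul_apply, Function.update_comm hi, Function.update_comm hj,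
    MultilinearMap.map_update_smul]

/-- `R^{(i,j)}`: the operator `R` on `V_i ⊗ V_j` acting on the factors `i` and `j` of
`V_1 ⊗ … ⊗ V_n`; it maps `v_1 ⊗ … ⊗ v_n` to the tensor obtained by putting `R (v_i ⊗ v_j)` into
the factors `i` and `j`. Only used for `i ≠ j`. -/
def twoSite (i j : Fin n) (R : Module.End ℂ (V i ⊗[ℂ] V j)) :
    Module.End ℂ (⨂[ℂ] k, V k) :=
  if hij : i ≠ j then
    PiTensorProduct.lift <| MultilinearMap.mk' (fun v => place hij v (R (v i ⊗ₜ[ℂ] v j)))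
      (fun v k x y => by
        by_cases hi : k = i
        · subst hi
          simp [place_update_left, Function.update_of_ne (Ne.symm hij), TensorProduct.add_tmul]
        by_cases hj : k = j
        · subst hj
          simp [place_update_right, Function.update_of_ne hij, TensorProduct.tmul_add]
        · simp [place_update_add hij hi hj, Function.update_of_ne (Ne.symm hi),
            Function.update_of_ne (Ne.symm hj)])
      (fun v k c x => by
        by_cases hi : k = i
        · subst hi
          simp [place_update_left, Function.update_of_ne (Ne.symm hij), ← TensorProduct.smul_tmul']
        by_cases hj : k = j
        · subst hj
          simp [place_update_right, Function.update_of_ne hij]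
        · simp [place_update_smul hij hi hj, Function.update_of_ne (Ne.symm hi),
            Function.update_of_ne (Ne.symm hj)])
  else 1

end Factors

/-! ### Differentiation of vector-valued functions -/

/-- Complex differentiability of a function of one complex variable with values in a complex
vector space `V`, possibly of infinite dimension: near `t` the function takes values in a
finite-dimensional subspace, and it has the derivative `v` at `t` in every linear coordinate. -/
def HasVecDerivAt {V : Type} [AddCommGroup V] [Module ℂ V] (g : ℂ → V) (v : V) (t : ℂ) : Prop :=
  (∃ W : Submodule ℂ V, FiniteDimensional ℂ W ∧ ∀ᶠ s in 𝓝 t, g s ∈ W) ∧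
    ∀ φ : V →ₗ[ℂ] ℂ, HasDerivAt (fun s => φ (g s)) (φ v) t

/-- `f` has the partial derivative `v` with respect to `λ_a` at the point `lam`. -/
def HasPartialAt {N : ℕ} {V : Type} [AddCommGroup V] [Module ℂ V]
    (a : Fin N) (f : (Fin N → ℂ) → V) (v : V) (lam : Fin N → ℂ) : Prop :=
  HasVecDerivAt (fun s => f (Function.update lam a s)) v (lam a)

open Classical in
/-- The partial derivative `∂f/∂λ_a` (with the value `0` where it does not exist). -/
def partialDeriv {N : ℕ} {V : Type} [AddCommGroup V] [Module ℂ V]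
    (a : Fin N) (f : (Fin N → ℂ) → V) (lam : Fin N → ℂ) : V :=
  if h : ∃ v, HasPartialAt a f v lam then h.choose else 0

/-! ### The qKZ and dynamical operators -/

section Operators

variable {N n : ℕ}

/-- The space `V_1 ⊗ … ⊗ V_n`, where `V_i` is the Verma module with highest weight `Λ i`. -/
abbrev Tens (Λ : Fin n → Fin N → ℂ) : Type := ⨂[ℂ] i, Verma (Λ i)

/-- `e_{a,b}^{(i)}`. -/
def eAt (Λ : Fin n → Fin N → ℂ) (i : Fin n) (a b : Fin N) : Module.End ℂ (Tens Λ) :=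
  site i (act (Λ i) a b)

/-- `e_{a,b} = ∑_i e_{a,b}^{(i)}` acting on the tensor product. -/
def eTot (Λ : Fin n → Fin N → ℂ) (a b : Fin N) : Module.End ℂ (Tens Λ) :=
  ∑ i, eAt Λ i a b

/-- `R^{(i,j)}_{V_i,V_j}(x)`. -/
def RAt (Λ : Fin n → Fin N → ℂ) (i j : Fin n) (x : ℂ) : Module.End ℂ (Tens Λ) :=
  twoSite (V := fun k => Verma (Λ k)) i j (rMatrix (Λ i) (Λ j) x)

/-- The product `R^{(1,m)}(z_1-z_m-p) ⋯ R^{(m-1,m)}(z_{m-1}-z_m-p)`. -/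
def RLeft (Λ : Fin n → Fin N → ℂ) (p : ℂ) (m : Fin n) (z : Fin n → ℂ) :
    Module.End ℂ (Tens Λ) :=
  (((List.finRange n).filter (fun l => l < m)).map
    (fun l => RAt Λ l m (z l - z m - p))).prod

/-- The product `R^{(m,n)}(z_m-z_n) ⋯ R^{(m,m+1)}(z_m-z_{m+1})`. -/
def RRight (Λ : Fin n → Fin N → ℂ) (m : Fin n) (z : Fin n → ℂ) : Module.End ℂ (Tens Λ) :=
  (((List.finRange n).reverse.filter (fun l => m < l)).map
    (fun l => RAt Λ m l (z m - z l))).prod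

/-- The operator `K_m(z; λ)`; the argument `ell` is the tuple of chosen values of `log λ_a`. -/
def K (Λ : Fin n → Fin N → ℂ) (p : ℂ) (m : Fin n) (z : Fin n → ℂ) (ell : Fin N → ℂ) :
    Module.End ℂ (Tens Λ) :=
  Ring.inverse (RLeft Λ p m z) * site m (torus (Λ m) ell) * RRight Λ m z

/-- The operator `L_a(z; λ)`. -/
def L (Λ : Fin n → Fin N → ℂ) (a : Fin N) (z : Fin n → ℂ) (lam : Fin N → ℂ) :
    Module.End ℂ (Tens Λ) :=
  (1 / 2 : ℂ) • (eTot Λ a a) ^ 2 - ∑ i, z i • eAt Λ i a a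
    - ∑ b, ∑ i, ∑ j ∈ Finset.univ.filter (fun j => i < j), eAt Λ i a b * eAt Λ j b a
    - ∑ b ∈ Finset.univ.filter (fun b => b ≠ a),
        (lam b / (lam a - lam b)) • (eTot Λ a b * eTot Λ b a - eTot Λ a a)

/-- The qKZ operator `Z_m = K_m(z; λ)⁻¹ T_{z_m}` on functions of `(z, λ)`, where `T_{z_m}` shifts
`z_m` by `p` and `ell` is a branch of `λ ↦ (log λ_1, …, log λ_N)`. -/
def Z (Λ : Fin n → Fin N → ℂ) (p : ℂ) (ell : (Fin N → ℂ) → Fin N → ℂ) (m : Fin n)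
    (f : (Fin n → ℂ) → (Fin N → ℂ) → Tens Λ) : (Fin n → ℂ) → (Fin N → ℂ) → Tens Λ :=
  fun z lam => Ring.inverse (K Λ p m z (ell lam)) (f (Function.update z m (z m + p)) lam)

/-- The dynamical operator `D_a = p λ_a ∂/∂λ_a + L_a(z; λ)` on functions of `(z, λ)`. -/
def D (Λ : Fin n → Fin N → ℂ) (p : ℂ) (a : Fin N)
    (f : (Fin n → ℂ) → (Fin N → ℂ) → Tens Λ) : (Fin n → ℂ) → (Fin N → ℂ) → Tens Λ :=
  fun z lam => (p * lam a) • partialDeriv a (f z) lam + L Λ a z lam (f z lam)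

end Operators

end QKZ

end

open scoped TensorProduct Topology

noncomputable section

namespace QKZ

attribute [local instance 100] LieRing.ofAssociativeRing

/-! ### Operators on one and on two factors -/

section FactorAlgebra

variable {n : ℕ} {V : Fin n → Type} [∀ i, AddCommGroup (V i)] [∀ i, Module ℂ (V i)]

/-! For an ordering of the factors, let G be the sum of all z_i e_{a,a}^{(i)} and of all
e_{a,b}^{(i)} e_{b,a}^{(j)} with i standing before j (`gaudin`). Then L_a is (e_{a,a})²/2, minus G
for the natural order, minus a λ-dependent sum in the total generators (`L_eq`). The diagonal case
of the intertwining relation says that R^{(i,j)}(z_i - z_j) carries G to the same expression with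
the neighbours i, j interchanged (`RAt_mul_gaudin`). R-matrices commute with the total action, so
only G changes.

Hence the right-hand product in K_m carries L_a at z to its version with m last. The left-hand
product carries L_a at the shifted point to its version with m first and z_m replaced by z_m + p.

The torus operator connects the two versions (`dynamical_conj`). Conjugation by it scales
e_{a,b}^{(m)} by λ_a/λ_b, and the coefficients λ_b/(λ_a - λ_b) are such that the change of the
λ-dependent sum compensates the move of m from last to first. What is left is p e_{a,a}^{(m)}, from
the shift of z_m (`inverse_K_mul_L`).

In K_m⁻¹ only the inverse torus factor depends on λ. Applying p λ_a ∂/∂λ_a to it produces -p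
e_{a,a}^{(m)}, which accounts for this remainder. The product rule holds although the spaces are
infinite-dimensional: the torus is diagonal in a fixed weight basis, and a differentiable function
locally involves finitely many basis vectors (`HasVecDerivAt.diagonal`). -/

theorem site_tprod (i : Fin n) (A : Module.End ℂ (V i)) (v : ∀ k, V k) :
    site i A (PiTensorProduct.tprod ℂ v) =
      PiTensorProduct.tprod ℂ (Function.update v i (A (v i))) := by
  rw [site, PiTensorProduct.map_tprod]
  congr 1
  funext k
  by_cases h : k = i
  · subst h; simp
  · simp [h]

/-- `A ↦ A^{(i)}` as an algebra homomorphism. -/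
def siteHom (i : Fin n) : Module.End ℂ (V i) →ₐ[ℂ] Module.End ℂ (⨂[ℂ] k, V k) :=
  AlgHom.ofLinearMap
    { toFun := site i
      map_add' := fun A B => by
        apply PiTensorProduct.ext
        ext v
        simp [site_tprod]
      map_smul' := fun c A => by
        apply PiTensorProduct.ext
        ext v
        simp [site_tprod] }
    (by
      apply PiTensorProduct.ext
      ext v
      simp [site_tprod])
    (fun A B => by
      apply PiTensorProduct.ext
      ext v
      simp [site_tprod])

theorem site_one (i : Fin n) : site i (1 : Module.End ℂ (V i)) = 1 :=
  map_one (siteHom i)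

theorem site_commute {i j : Fin n} (hij : i ≠ j) (A : Module.End ℂ (V i))
    (B : Module.End ℂ (V j)) : Commute (site i A) (site j B) := by
  apply PiTensorProduct.ext
  ext v
  simp [site_tprod, Function.update_of_ne hij, Function.update_of_ne hij.symm,
    Function.update_comm hij]

theorem place_self {i j : Fin n} (hij : i ≠ j) (v : ∀ k, V k) :
    place hij v (v i ⊗ₜ[ℂ] v j) = PiTensorProduct.tprod ℂ v := by
  simp [place_tmul]

theorem twoSite_tprod {i j : Fin n} (hij : i ≠ j) (R : Module.End ℂ (V i ⊗[ℂ] V j))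
    (v : ∀ k, V k) :
    twoSite i j R (PiTensorProduct.tprod ℂ v) = place hij v (R (v i ⊗ₜ[ℂ] v j)) := by
  simp [twoSite, hij]

/-- On pure tensors this follows because `place hij v` does not depend on the entries i and j of v.
It is what makes `twoSite` multiplicative. -/
theorem twoSite_place {i j : Fin n} (hij : i ≠ j) (R : Module.End ℂ (V i ⊗[ℂ] V j))
    (v : ∀ k, V k) (t : V i ⊗[ℂ] V j) :
    twoSite i j R (place hij v t) = place hij v (R t) := by
  induction t with
  | zero => simp
  | add s t hs ht => simp [hs, ht]
  | tmul x y =>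
    rw [place_tmul, twoSite_tprod hij, place_update_right, place_update_left]
    simp [Function.update_of_ne hij]

/-- `R ↦ R^{(i,j)}` as an algebra homomorphism. -/
def twoSiteHom {i j : Fin n} (hij : i ≠ j) :
    Module.End ℂ (V i ⊗[ℂ] V j) →ₐ[ℂ] Module.End ℂ (⨂[ℂ] k, V k) :=
  AlgHom.ofLinearMap
    { toFun := twoSite i j
      map_add' := fun A B => by
        apply PiTensorProduct.ext
        ext v
        simp [twoSite_tprod hij]
      map_smul' := fun c A => by
        apply PiTensorProduct.ext
        ext v
        simp [twoSite_tprod hij] }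
    (by
      apply PiTensorProduct.ext
      ext v
      simp [twoSite_tprod hij, place_self])
    (fun A B => by
      apply PiTensorProduct.ext
      ext v
      simp [twoSite_tprod hij, twoSite_place hij])

theorem twoSiteHom_apply {i j : Fin n} (hij : i ≠ j) (R : Module.End ℂ (V i ⊗[ℂ] V j)) :
    twoSiteHom hij R = twoSite i j R := rfl

theorem twoSiteHom_map_left {i j : Fin n} (hij : i ≠ j) (A : Module.End ℂ (V i)) :
    twoSiteHom hij (TensorProduct.map A 1) = site i A := by
  apply PiTensorProduct.ext
  ext v
  simp [twoSiteHom_apply, twoSite_tprod hij, site_tprod, place_tmul,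
    Function.update_comm hij]

theorem twoSiteHom_map_right {i j : Fin n} (hij : i ≠ j) (B : Module.End ℂ (V j)) :
    twoSiteHom hij (TensorProduct.map 1 B) = site j B := by
  apply PiTensorProduct.ext
  ext v
  simp [twoSiteHom_apply, twoSite_tprod hij, site_tprod, place_tmul]

theorem twoSiteHom_map {i j : Fin n} (hij : i ≠ j) (A : Module.End ℂ (V i))
    (B : Module.End ℂ (V j)) :
    twoSiteHom hij (TensorProduct.map A B) = site i A * site j B := by
  rw [← twoSiteHom_map_left hij, ← twoSiteHom_map_right hij, ← map_mul, ← TensorProduct.map_mul]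
  simp

theorem site_place {i j k : Fin n} (hij : i ≠ j) (hi : k ≠ i) (hj : k ≠ j)
    (A : Module.End ℂ (V k)) (v : ∀ k, V k) (t : V i ⊗[ℂ] V j) :
    site k A (place hij v t) = place hij (Function.update v k (A (v k))) t := by
  induction t with
  | zero => simp
  | add s t hs ht => simp [hs, ht]
  | tmul x y =>
    rw [place_tmul, site_tprod, place_tmul, Function.update_comm hi, Function.update_comm hj]
    simp [Function.update_of_ne hi, Function.update_of_ne hj]

theorem twoSite_commute_site {i j k : Fin n} (hij : i ≠ j) (hi : k ≠ i) (hj : k ≠ j)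
    (R : Module.End ℂ (V i ⊗[ℂ] V j)) (A : Module.End ℂ (V k)) :
    Commute (twoSite i j R) (site k A) := by
  apply PiTensorProduct.ext
  ext v
  simp [site_tprod, twoSite_tprod hij, site_place hij hi hj, Function.update_of_ne hi.symm,
    Function.update_of_ne hj.symm]

end FactorAlgebra

/-! ### Diagonal operators -/

section Diagonal

variable {V ι : Type*} [AddCommGroup V] [Module ℂ V]

/-- A coordinate of a vector with respect to an eigenbasis of `A` is multiplied by the
corresponding eigenvalue under `A`. -/
theorem coord_apply_of_eigenbasis (B : Module.Basis ι ℂ V) (c : ι → ℂ) (A : Module.End ℂ V)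
    (h : ∀ k, A (B k) = c k • B k) (k : ι) (w : V) : B.coord k (A w) = c k * B.coord k w := by
  have : B.coord k ∘ₗ A = c k • B.coord k := by
    refine B.ext fun j => ?_
    by_cases hj : j = k
    · subst hj; simp [h]
    · simp [h, hj]
  exact LinearMap.congr_fun this w

end Diagonal

/-! ### Weights of Verma modules -/

variable {N : ℕ}

theorem e_mul_e (a b c d : Fin N) :
    (e a b * e c d : U N) =
      e c d * e a b + (if b = c then e a d else 0) - (if a = d then e c b else 0) := by
  have h := LieHom.map_lie (UniversalEnvelopingAlgebra.ι ℂ)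
    (Matrix.single a b (1 : ℂ)) (Matrix.single c d (1 : ℂ))
  rw [LieRing.of_associative_ring_bracket, LieRing.of_associative_ring_bracket, map_sub] at h
  have h1 : UniversalEnvelopingAlgebra.ι ℂ (Matrix.single a b (1 : ℂ) * Matrix.single c d 1) =
      if b = c then (e a d : U N) else 0 := by
    split_ifs with hbc
    · subst hbc; simp [e]
    · rw [Matrix.single_mul_single_of_ne _ _ _ _ hbc, map_zero]
  have h2 : UniversalEnvelopingAlgebra.ι ℂ (Matrix.single c d (1 : ℂ) * Matrix.single a b 1) =
      if a = d then (e c b : U N) else 0 := by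
    split_ifs with hbc
    · subst hbc; simp [e]
    · rw [Matrix.single_mul_single_of_ne _ _ _ _ (Ne.symm hbc), map_zero]
  rw [h1, h2] at h
  rw [add_sub_assoc, h]
  simp [e]

theorem act_apply (Λ : Fin N → ℂ) (a b : Fin N) (w : Verma Λ) : act Λ a b w = e a b • w := rfl

/-- `w` is a vector of weight `μ`. -/
def IsWeight (Λ : Fin N → ℂ) (μ : Fin N → ℂ) (w : Verma Λ) : Prop :=
  ∀ a, act Λ a a w = μ a • w

theorem isWeight_hwv (Λ : Fin N → ℂ) : IsWeight Λ Λ (hwv Λ) := by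
  intro a
  have h : e a a - algebraMap ℂ (U N) (Λ a) ∈ vermaIdeal Λ :=
    Submodule.subset_span (Or.inr ⟨a, rfl⟩)
  have h2 := (Submodule.Quotient.eq (vermaIdeal Λ)).mpr h
  rw [Algebra.algebraMap_eq_smul_one] at h2
  have h3 : (Submodule.Quotient.mk (e a a) : U N ⧸ vermaIdeal Λ) =
      e a a • (Submodule.Quotient.mk 1 : U N ⧸ vermaIdeal Λ) := by
    rw [← Submodule.Quotient.mk_smul, smul_eq_mul, mul_one]
  rw [h3] at h2
  exact h2

theorem IsWeight.act {Λ μ : Fin N → ℂ} {w : Verma Λ} (h : IsWeight Λ μ w) (a b : Fin N) :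
    IsWeight Λ (μ + Pi.single a 1 - Pi.single b 1) (act Λ a b w) := by
  intro c
  have hc := h c
  rw [act_apply] at hc ⊢
  rw [act_apply, ← mul_smul, e_mul_e, sub_smul, add_smul, mul_smul, hc, smul_comm]
  simp only [Pi.sub_apply, Pi.add_apply, Pi.single_apply, sub_smul, add_smul, ite_smul, one_smul,
    zero_smul]
  congr 1
  · congr 1
    split_ifs with hca
    · subst hca; rfl
    · rfl
  · split_ifs with hca
    · subst hca; rfl
    · rfl

/-- A subspace which is stable under the Lie algebra is stable under its enveloping algebra. -/
theorem smul_mem_of_forall_ι {L M : Type*} [LieRing L] [LieAlgebra ℂ L] [AddCommGroup M]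
    [Module ℂ M] [Module (UniversalEnvelopingAlgebra ℂ L) M]
    [IsScalarTower ℂ (UniversalEnvelopingAlgebra ℂ L) M] (P : Submodule ℂ M)
    (h : ∀ x, ∀ w ∈ P, UniversalEnvelopingAlgebra.ι ℂ (x : L) • w ∈ P)
    (u : UniversalEnvelopingAlgebra ℂ L) : ∀ w ∈ P, u • w ∈ P := by
  obtain ⟨t, rfl⟩ : ∃ t, UniversalEnvelopingAlgebra.mkAlgHom ℂ L t = u :=
    Quotient.exists_rep u
  induction t using TensorAlgebra.induction with
  | algebraMap r =>
    intro w hw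
    rw [AlgHom.commutes, algebraMap_smul]
    exact P.smul_mem r hw
  | ι x => exact h x
  | mul a b ha hb =>
    intro w hw
    rw [map_mul, mul_smul]
    exact ha _ (hb _ hw)
  | add a b ha hb =>
    intro w hw
    rw [map_add, add_smul]
    exact P.add_mem (ha _ hw) (hb _ hw)

/-- A Verma module is spanned by its weight vectors. -/
theorem span_weight (Λ : Fin N → ℂ) :
    Submodule.span ℂ {w : Verma Λ | ∃ μ, IsWeight Λ μ w} = ⊤ := by
  set P := Submodule.span ℂ {w : Verma Λ | ∃ μ, IsWeight Λ μ w} with hP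
  have hact : ∀ a b, ∀ w ∈ P, act Λ a b w ∈ P := by
    intro a b w hw
    have : P ≤ P.comap (act Λ a b) := by
      conv_lhs => rw [hP]
      refine Submodule.span_le.mpr ?_
      rintro w ⟨μ, h⟩
      exact Submodule.subset_span ⟨_, h.act a b⟩
    exact this hw
  have hι : ∀ x : Matrix (Fin N) (Fin N) ℂ, ∀ w ∈ P,
      UniversalEnvelopingAlgebra.ι ℂ x • w ∈ P := by
    intro x w hw
    have hx : UniversalEnvelopingAlgebra.ι ℂ x • w = ∑ i, ∑ j, x i j • act Λ i j w := by
      conv_lhs => rw [Matrix.matrix_eq_sum_single x]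
      simp only [map_sum, Finset.sum_smul]
      refine Finset.sum_congr rfl fun i _ => Finset.sum_congr rfl fun j _ => ?_
      have : Matrix.single i j (x i j) = x i j • Matrix.single i j (1 : ℂ) := by simp
      rw [this, map_smul, smul_assoc]
      rfl
    rw [hx]
    exact P.sum_mem fun i _ => P.sum_mem fun j _ => P.smul_mem _ (hact i j w hw)
  rw [eq_top_iff]
  intro w _
  obtain ⟨u, rfl⟩ := Submodule.Quotient.mk_surjective (vermaIdeal Λ) w
  have h1 : (Submodule.Quotient.mk u : U N ⧸ vermaIdeal Λ) =
      u • (Submodule.Quotient.mk 1 : U N ⧸ vermaIdeal Λ) := by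
    rw [← Submodule.Quotient.mk_smul, smul_eq_mul, mul_one]
  rw [h1]
  exact smul_mem_of_forall_ι P hι u (hwv Λ) (Submodule.subset_span ⟨Λ, isWeight_hwv Λ⟩)

/-- The content is that the operator sought in the definition of `torus` exists, so that the default
value 0 is not taken. It is defined on a basis of weight vectors. A vector of weight μ has nonzero
coordinates only at basis vectors of weight μ, so it is scaled correctly as well. -/
theorem torus_apply {Λ μ : Fin N → ℂ} {w : Verma Λ} (h : IsWeight Λ μ w) (ell : Fin N → ℂ) :
    torus Λ ell w = Complex.exp (∑ a, ell a * μ a) • w := by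
  have hex : ∃ A : Module.End ℂ (Verma Λ), ∀ (μ : Fin N → ℂ) (w : Verma Λ),
      (∀ a, act Λ a a w = μ a • w) → A w = Complex.exp (∑ a, ell a * μ a) • w := by
    let B := Module.Basis.ofSpan (span_weight Λ).ge
    have hB : ∀ k, ∃ μ, IsWeight Λ μ (B k) := fun k =>
      Module.Basis.ofSpan_subset (span_weight Λ).ge ⟨k, rfl⟩
    choose ν hν using hB
    refine ⟨B.constr ℂ fun k => Complex.exp (∑ a, ell a * ν k a) • B k, fun μ w hw => ?_⟩
    refine B.ext_elem fun k => ?_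
    have h1 := coord_apply_of_eigenbasis B (fun k => Complex.exp (∑ a, ell a * ν k a))
      (B.constr ℂ fun k => Complex.exp (∑ a, ell a * ν k a) • B k)
      (fun k => B.constr_basis ℂ _ k) k w
    simp only [Module.Basis.coord_apply] at h1
    rw [h1, map_smul, Finsupp.smul_apply, smul_eq_mul]
    by_cases h0 : B.repr w k = 0
    · simp [h0]
    · congr 3
      funext a
      have h2 := coord_apply_of_eigenbasis B (fun k => ν k a) (QKZ.act Λ a a)
        (fun k => hν k a) k w
      rw [hw a] at h2
      simp only [Module.Basis.coord_apply, map_smul, smul_eq_mul] at h2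
      rw [mul_right_cancel₀ h0 h2]
  rw [torus, dif_pos hex]
  exact hex.choose_spec μ w h

theorem ext_weight {Λ : Fin N → ℂ} {M : Type*} [AddCommGroup M] [Module ℂ M]
    {A B : Verma Λ →ₗ[ℂ] M} (h : ∀ μ w, IsWeight Λ μ w → A w = B w) : A = B :=
  LinearMap.ext_on (span_weight Λ) fun w ⟨μ, hw⟩ => h μ w hw

theorem torus_mul_torus_neg (Λ ell : Fin N → ℂ) : torus Λ ell * torus Λ (-ell) = 1 := by
  refine ext_weight fun μ w hw => ?_
  rw [Module.End.mul_apply, torus_apply hw, map_smul, torus_apply hw, smul_smul,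
    ← Complex.exp_add, ← Finset.sum_add_distrib]
  simp

/-- Since e_{a,b} shifts the weight by ε_a - ε_b, the torus eigenvalue changes by the factor
exp(ell_a - ell_b). -/
theorem torus_mul_act (Λ ell : Fin N → ℂ) (a b : Fin N) :
    torus Λ ell * act Λ a b =
      (Complex.exp (ell a) / Complex.exp (ell b)) • (act Λ a b * torus Λ ell) := by
  refine ext_weight fun μ w hw => ?_
  rw [LinearMap.smul_apply, Module.End.mul_apply, Module.End.mul_apply, torus_apply (hw.act a b),
    torus_apply hw, map_smul, smul_smul, ← Complex.exp_sub, ← Complex.exp_add]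
  congr 2
  simp only [Pi.sub_apply, Pi.add_apply, mul_sub, mul_add, Finset.sum_sub_distrib,
    Finset.sum_add_distrib, Pi.single_apply]
  simp
  ring

/-! ### R-matrices on the tensor product -/

section Reorder

variable {N n : ℕ} (Λ : Fin n → Fin N → ℂ)

theorem isRMatrix_rMatrix {Λ₁ Λ₂ : Fin N → ℂ} {x : ℂ} (h : IsGeneric Λ₁ Λ₂ x) :
    IsRMatrix Λ₁ Λ₂ x (rMatrix Λ₁ Λ₂ x) := by
  rw [rMatrix, dif_pos h]
  exact h.choose_spec.1

variable {Λ}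

theorem isUnit_RAt {i j : Fin n} (hij : i ≠ j) {x : ℂ} (h : IsGeneric (Λ i) (Λ j) x) :
    IsUnit (RAt Λ i j x) := by
  have h1 : IsUnit (rMatrix (Λ i) (Λ j) x) :=
    (Module.End.isUnit_iff _).mpr (isRMatrix_rMatrix h).bijective
  exact h1.map (twoSiteHom (V := fun k => Verma (Λ k)) hij)

theorem RAt_commute_eAt {i j k : Fin n} (hij : i ≠ j) (hi : k ≠ i) (hj : k ≠ j) (x : ℂ)
    (a b : Fin N) : Commute (RAt Λ i j x) (eAt Λ k a b) :=
  twoSite_commute_site hij hi hj _ _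

theorem RAt_commute_add {i j : Fin n} (hij : i ≠ j) {x : ℂ} (h : IsGeneric (Λ i) (Λ j) x)
    (a b : Fin N) : Commute (RAt Λ i j x) (eAt Λ i a b + eAt Λ j a b) := by
  have := congrArg (twoSiteHom (V := fun k => Verma (Λ k)) hij)
    ((isRMatrix_rMatrix h).commute a b)
  simp only [map_mul, map_add, twoSiteHom_map_left, twoSiteHom_map_right] at this
  exact this

theorem RAt_intertwine {i j : Fin n} (hij : i ≠ j) {x : ℂ} (h : IsGeneric (Λ i) (Λ j) x)
    (a b : Fin N) :
    RAt Λ i j x * (x • eAt Λ j a b - ∑ c, eAt Λ i a c * eAt Λ j c b) =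
      (x • eAt Λ j a b - ∑ c, eAt Λ i c b * eAt Λ j a c) * RAt Λ i j x := by
  have := congrArg (twoSiteHom (V := fun k => Verma (Λ k)) hij)
    ((isRMatrix_rMatrix h).intertwine a b)
  simp only [map_mul, map_sub, map_smul, map_sum, twoSiteHom_map, site_one, one_mul] at this
  exact this

theorem eAt_commute {i j : Fin n} (hij : i ≠ j) (a b c d : Fin N) :
    Commute (eAt Λ i a b) (eAt Λ j c d) :=
  site_commute hij _ _

/-! ### Ordered sums -/

variable (Λ)

/-- The sum of `e_{a,b}^{(i)}` over the members `i` of a list. -/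
def eList (l : List (Fin n)) (a b : Fin N) : Module.End ℂ (Tens Λ) :=
  (l.map fun i => eAt Λ i a b).sum

/-- The sum of `z_i e_{a,a}^{(i)}` over the members `i` of a list and of
`∑_b e_{a,b}^{(i)} e_{b,a}^{(j)}` over its pairs of members, `i` standing before `j`. -/
def gaudin (a : Fin N) (z : Fin n → ℂ) : List (Fin n) → Module.End ℂ (Tens Λ)
  | [] => 0
  | i :: l => z i • eAt Λ i a a + ∑ b, eAt Λ i a b * eList Λ l b a + gaudin a z l

variable {Λ}

theorem eList_cons (i : Fin n) (l : List (Fin n)) (a b : Fin N) :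
    eList Λ (i :: l) a b = eAt Λ i a b + eList Λ l a b := by
  simp [eList]

theorem eList_append (l l' : List (Fin n)) (a b : Fin N) :
    eList Λ (l ++ l') a b = eList Λ l a b + eList Λ l' a b := by
  simp [eList]

theorem eList_nil (a b : Fin N) : eList Λ [] a b = 0 := rfl

theorem eList_finRange (a b : Fin N) : eList Λ (List.finRange n) a b = eTot Λ a b := by
  rw [eTot, eList, Fin.sum_univ_def]

/-- Two blocks interact only through their block sums, which are insensitive to the order inside a
block. This isolates a pair of neighbours from the rest of the list. -/
theorem gaudin_append (a : Fin N) (z : Fin n → ℂ) (l l' : List (Fin n)) :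
    gaudin Λ a z (l ++ l') =
      gaudin Λ a z l + ∑ b, eList Λ l a b * eList Λ l' b a + gaudin Λ a z l' := by
  induction l with
  | nil => simp [gaudin, eList_nil]
  | cons i l ih =>
    simp only [List.cons_append, gaudin, ih, eList_append, eList_cons, mul_add, add_mul,
      Finset.sum_add_distrib]
    abel

theorem gaudin_congr {a : Fin N} {z z' : Fin n → ℂ} {l : List (Fin n)}
    (h : ∀ i ∈ l, z i = z' i) : gaudin Λ a z l = gaudin Λ a z' l := by
  induction l with
  | nil => rfl
  | cons i l ih =>
    rw [gaudin, gaudin, h i (by simp), ih fun k hk => h k (List.mem_cons_of_mem _ hk)]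

theorem commute_eList {A : Module.End ℂ (Tens Λ)} {l : List (Fin n)} {a b : Fin N}
    (h : ∀ i ∈ l, Commute A (eAt Λ i a b)) : Commute A (eList Λ l a b) := by
  induction l with
  | nil => simp [eList_nil]
  | cons i l ih =>
    rw [eList_cons]
    exact (h i (by simp)).add_right (ih fun k hk => h k (List.mem_cons_of_mem _ hk))

theorem commute_gaudin {A : Module.End ℂ (Tens Λ)} {l : List (Fin n)} {a : Fin N}
    {z : Fin n → ℂ} (h : ∀ i ∈ l, ∀ a b, Commute A (eAt Λ i a b)) :
    Commute A (gaudin Λ a z l) := by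
  induction l with
  | nil => simp [gaudin]
  | cons i l ih =>
    rw [gaudin]
    have hl : ∀ k ∈ l, ∀ a b, Commute A (eAt Λ k a b) :=
      fun k hk => h k (List.mem_cons_of_mem _ hk)
    refine (((h i (by simp) a a).smul_right _).add_right ?_).add_right (ih hl)
    exact Commute.sum_right _ _ _ fun b _ =>
      (h i (by simp) a b).mul_right (commute_eList fun k hk => hl k hk _ _)

/-! ### Reordering the factors by R-matrices. -/

theorem gaudin_pair (a : Fin N) (z : Fin n → ℂ) (i j : Fin n) :
    gaudin Λ a z [i, j] =
      z i • eAt Λ i a a + z j • eAt Λ j a a + ∑ b, eAt Λ i a b * eAt Λ j b a := by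
  simp only [gaudin, eList_cons, eList_nil, mul_zero, add_zero, Finset.sum_const_zero]
  abel

/-- The R-matrix interchanges two neighbours of a pair. -/
theorem RAt_mul_gaudin_pair {i j : Fin n} (hij : i ≠ j) (a : Fin N) (z : Fin n → ℂ)
    (h : IsGeneric (Λ i) (Λ j) (z i - z j)) :
    RAt Λ i j (z i - z j) * gaudin Λ a z [i, j] =
      gaudin Λ a z [j, i] * RAt Λ i j (z i - z j) := by
  have h1 := RAt_intertwine hij h a a
  have h2 := (RAt_commute_add hij h a a).eq
  -- Splitting off z_i times the pair's total e_{a,a}, which commutes with R, leaves exactly the two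
  -- sides of the intertwining relation at spectral parameter z_i - z_j.
  have e1 : gaudin Λ a z [i, j] = z i • (eAt Λ i a a + eAt Λ j a a) -
      ((z i - z j) • eAt Λ j a a - ∑ c, eAt Λ i a c * eAt Λ j c a) := by
    rw [gaudin_pair]
    module
  have e2 : gaudin Λ a z [j, i] = z i • (eAt Λ i a a + eAt Λ j a a) -
      ((z i - z j) • eAt Λ j a a - ∑ c, eAt Λ i c a * eAt Λ j a c) := by
    rw [gaudin_pair]
    simp only [fun c => (eAt_commute (Λ := Λ) hij c a a c).eq]
    module
  rw [e1, e2, mul_sub, sub_mul, h1, mul_smul_comm, smul_mul_assoc, h2]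

/-- The R-matrix interchanges two neighbours in a list. -/
theorem RAt_mul_gaudin {i j : Fin n} {l l' : List (Fin n)} (hl : (l ++ i :: j :: l').Nodup)
    (a : Fin N) (z : Fin n → ℂ) (h : IsGeneric (Λ i) (Λ j) (z i - z j)) :
    RAt Λ i j (z i - z j) * gaudin Λ a z (l ++ i :: j :: l') =
      gaudin Λ a z (l ++ j :: i :: l') * RAt Λ i j (z i - z j) := by
  have hij : i ≠ j := by
    rintro rfl
    simp [List.nodup_append] at hl
  have hne : ∀ k ∈ l ++ l', k ≠ i ∧ k ≠ j := by
    intro k hk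
    simp only [List.nodup_append, List.nodup_cons, List.mem_cons] at hl
    rcases List.mem_append.mp hk with hk | hk
    · exact ⟨hl.2.2 k hk i (Or.inl rfl), hl.2.2 k hk j (Or.inr (Or.inl rfl))⟩
    · constructor <;> rintro rfl <;> tauto
  have hc : ∀ k ∈ l ++ l', ∀ a b, Commute (RAt Λ i j (z i - z j)) (eAt Λ k a b) :=
    fun k hk a b => RAt_commute_eAt hij (hne k hk).1 (hne k hk).2 _ a b
  have hcl : ∀ k ∈ l, ∀ a b, Commute (RAt Λ i j (z i - z j)) (eAt Λ k a b) :=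
    fun k hk => hc k (List.mem_append_left _ hk)
  have hcl' : ∀ k ∈ l', ∀ a b, Commute (RAt Λ i j (z i - z j)) (eAt Λ k a b) :=
    fun k hk => hc k (List.mem_append_right _ hk)
  have hE : ∀ a b, Commute (RAt Λ i j (z i - z j)) (eList Λ [i, j] a b) := by
    intro a b
    simpa [eList_cons, eList_nil] using RAt_commute_add hij h a b
  have hswap : ∀ a b, eList Λ [j, i] a b = eList Λ [i, j] a b := by
    intro a b
    simp [eList_cons, eList_nil, add_comm]
  have e1 : l ++ i :: j :: l' = l ++ ([i, j] ++ l') := rfl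
  have e2 : l ++ j :: i :: l' = l ++ ([j, i] ++ l') := rfl
  rw [e1, e2]
  simp only [gaudin_append, eList_append, hswap, mul_add, add_mul]
  rw [RAt_mul_gaudin_pair hij a z h, (commute_gaudin hcl).eq, (commute_gaudin hcl').eq,
    (Commute.sum_right _ _ _ fun b _ => (hE a b).mul_right
      (commute_eList fun k hk => hcl' k hk b a)).eq,
    (Commute.sum_right _ _ _ fun b _ => ((commute_eList fun k hk => hcl k hk a b).mul_right
      (hE b a)).add_right ((commute_eList fun k hk => hcl k hk a b).mul_right
        (commute_eList fun k hk => hcl' k hk b a))).eq]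

/-- A product of R-matrices moves `m` to the right past a list. -/
theorem prod_RAt_mul_gaudin_right {m : Fin n} (a : Fin N) (z : Fin n → ℂ) (l' : List (Fin n)) :
    ∀ l : List (Fin n), (l ++ m :: l').Nodup →
      (∀ j ∈ l', IsGeneric (Λ m) (Λ j) (z m - z j)) →
      (l'.reverse.map fun j => RAt Λ m j (z m - z j)).prod * gaudin Λ a z (l ++ m :: l') =
        gaudin Λ a z (l ++ (l' ++ [m])) *
          (l'.reverse.map fun j => RAt Λ m j (z m - z j)).prod := by
  induction l' with
  | nil => intro l _ _; simp
  | cons j l' ih =>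
    intro l hl h
    have hl2 : ((l ++ [j]) ++ m :: l').Nodup := by
      refine (List.Perm.nodup_iff ?_).mp hl
      simpa using (List.Perm.swap j m l').append_left l
    have := ih (l ++ [j]) hl2 fun k hk => h k (List.mem_cons_of_mem _ hk)
    -- Once m has passed j, the entry j joins the prefix; hence the induction is over all prefixes.
    simp only [List.append_assoc, List.singleton_append] at this
    simp only [List.reverse_cons, List.map_append, List.prod_append, List.map_cons, List.map_nil,
      List.prod_singleton, List.cons_append]
    rw [mul_assoc, RAt_mul_gaudin hl a z (h j (by simp)), ← mul_assoc, this, mul_assoc]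

/-- A product of R-matrices moves `m` to the left past a list. -/
theorem prod_RAt_mul_gaudin_left {m : Fin n} (a : Fin N) (z : Fin n → ℂ) (l₂ : List (Fin n))
    (l' : List (Fin n)) :
    ∀ l : List (Fin n), (l ++ (l' ++ m :: l₂)).Nodup →
      (∀ j ∈ l', IsGeneric (Λ j) (Λ m) (z j - z m)) →
      (l'.map fun j => RAt Λ j m (z j - z m)).prod * gaudin Λ a z (l ++ (l' ++ m :: l₂)) =
        gaudin Λ a z (l ++ m :: (l' ++ l₂)) *
          (l'.map fun j => RAt Λ j m (z j - z m)).prod := by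
  induction l' with
  | nil => intro l _ _; simp
  | cons j l' ih =>
    intro l hl h
    have hl2 : ((l ++ [j]) ++ (l' ++ m :: l₂)).Nodup := by simpa using hl
    have hl3 : (l ++ j :: m :: (l' ++ l₂)).Nodup := by
      refine (List.Perm.nodup_iff ?_).mp hl
      exact (List.perm_middle.cons j).append_left l
    have := ih (l ++ [j]) hl2 fun k hk => h k (List.mem_cons_of_mem _ hk)
    simp only [List.append_assoc, List.singleton_append] at this
    simp only [List.map_cons, List.prod_cons, List.cons_append]
    rw [mul_assoc, this, ← mul_assoc, RAt_mul_gaudin hl3 a z (h j (by simp)), mul_assoc]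

/-- In an increasing list the entries standing after i are those greater than i. This links the list
recursion to the sum over i < j in L_a. -/
theorem gaudin_eq_of_pairwise (a : Fin N) (z : Fin n → ℂ) {l : List (Fin n)}
    (hl : l.Pairwise (· < ·)) :
    gaudin Λ a z l = (l.map fun i => z i • eAt Λ i a a).sum +
      ∑ b, (l.map fun i => eAt Λ i a b * eList Λ (l.filter (i < ·)) b a).sum := by
  induction l with
  | nil => simp [gaudin]
  | cons i l ih =>
    rw [List.pairwise_cons] at hl
    have h1 : (i :: l).filter (i < ·) = l := by
      rw [List.filter_cons_of_neg (by simp)]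
      exact List.filter_eq_self.mpr fun k hk => by simpa using hl.1 k hk
    have h2 : ∀ b, (l.map fun k => eAt Λ k a b * eList Λ ((i :: l).filter (k < ·)) b a) =
        l.map fun k => eAt Λ k a b * eList Λ (l.filter (k < ·)) b a := by
      refine fun b => List.map_congr_left fun k hk => ?_
      rw [List.filter_cons_of_neg (by simpa using (hl.1 k hk).le)]
    simp only [List.map_cons, List.sum_cons, h1, h2, Finset.sum_add_distrib]
    rw [gaudin, ih hl.2]
    abel

theorem gaudin_finRange (a : Fin N) (z : Fin n → ℂ) :
    gaudin Λ a z (List.finRange n) = ∑ i, z i • eAt Λ i a a +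
      ∑ b, ∑ i, ∑ j ∈ Finset.univ.filter (fun j => i < j), eAt Λ i a b * eAt Λ j b a := by
  have hs : ∀ i b, eList Λ ((List.finRange n).filter (i < ·)) b a =
      ∑ j ∈ Finset.univ.filter (fun j => i < j), eAt Λ j b a := by
    intro i b
    rw [eList, ← List.sum_toFinset _ ((List.nodup_finRange n).filter _)]
    refine Finset.sum_congr ?_ fun _ _ => rfl
    ext j
    simp
  rw [gaudin_eq_of_pairwise a z (List.pairwise_lt_finRange n)]
  simp only [hs, Fin.sum_univ_def, Finset.mul_sum]

/-- Both sides are strictly increasing lists with the same members. -/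
theorem finRange_eq_append (m : Fin n) :
    List.finRange n = (List.finRange n).filter (fun l => l < m) ++
      m :: (List.finRange n).filter (fun l => m < l) := by
  refine List.Perm.eq_of_pairwise (le := (· < ·)) (fun a b _ _ h1 h2 => (lt_asymm h1 h2).elim)
    (List.pairwise_lt_finRange n) ?_ ?_
  · refine List.pairwise_append.mpr ⟨(List.pairwise_lt_finRange n).filter _,
      List.pairwise_cons.mpr ⟨by simp, (List.pairwise_lt_finRange n).filter _⟩, ?_⟩
    intro a ha b hb
    simp only [List.mem_filter, List.mem_finRange, true_and, decide_eq_true_eq,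
      List.mem_cons] at ha hb
    rcases hb with rfl | hb
    · exact ha
    · exact ha.trans hb
  · refine (List.perm_ext_iff_of_nodup (List.nodup_finRange n) ?_).mpr fun k => ?_
    · simp only [List.nodup_append, List.nodup_cons]
      refine ⟨(List.nodup_finRange n).filter _, ⟨by simp, (List.nodup_finRange n).filter _⟩, ?_⟩
      rintro a ha _ hb rfl
      simp at ha hb
      omega
    · simp
      omega

end Reorder

/-! ### Commutation of `K_m` and `L_a` -/

/-- Conjugation by `T` turns the Gaudin-type operator in which the factor `M` stands last into the
one in which it stands first, the difference being absorbed by the dynamical term. -/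
theorem dynamical_conj {N : ℕ} {A : Type*} [Ring A] [Algebra ℂ A] (M E : Fin N → Fin N → A)
    (T X : A) (lam : Fin N → ℂ) (a : Fin N) (h0 : ∀ b, lam b ≠ 0)
    (hne : ∀ b, b ≠ a → lam a ≠ lam b)
    (hTM : ∀ b c, T * M b c = (lam b / lam c) • (M b c * T))
    (hTE : ∀ b c, T * E b c = E b c * T) (hTX : T * X = X * T)
    (hME : M a a * E a a = E a a * M a a) (w p : ℂ) :
    ((1 / 2 : ℂ) • (E a a + M a a) ^ 2 - ((w + p) • M a a + ∑ b, M a b * E b a + X) -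
      ∑ b ∈ Finset.univ.filter (fun b => b ≠ a), (lam b / (lam a - lam b)) •
        ((E a b + M a b) * (E b a + M b a) - (E a a + M a a))) * T =
    T * ((1 / 2 : ℂ) • (E a a + M a a) ^ 2 - (X + ∑ b, E a b * M b a + w • M a a) -
      ∑ b ∈ Finset.univ.filter (fun b => b ≠ a), (lam b / (lam a - lam b)) •
        ((E a b + M a b) * (E b a + M b a) - (E a a + M a a))) - p • (M a a * T) := by
  have hMa : T * M a a = M a a * T := by rw [hTM, div_self (h0 a), one_smul]
  have hS : T * (E a a + M a a) = (E a a + M a a) * T := by rw [mul_add, hTE, hMa, add_mul]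
  have hS2 : T * (E a a + M a a) ^ 2 = (E a a + M a a) ^ 2 * T :=
    (show Commute T (E a a + M a a) from hS).pow_right 2
  have hG : T * ∑ b, E a b * M b a = (∑ b, (lam b / lam a) • (E a b * M b a)) * T := by
    rw [Finset.mul_sum, Finset.sum_mul]
    refine Finset.sum_congr rfl fun b _ => ?_
    rw [← mul_assoc, hTE, mul_assoc, hTM, mul_smul_comm, smul_mul_assoc, mul_assoc]
  have hD : T * ∑ b ∈ Finset.univ.filter (fun b => b ≠ a), (lam b / (lam a - lam b)) •
        ((E a b + M a b) * (E b a + M b a) - (E a a + M a a)) =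
      (∑ b ∈ Finset.univ.filter (fun b => b ≠ a), (lam b / (lam a - lam b)) •
        ((E a b + (lam a / lam b) • M a b) * (E b a + (lam b / lam a) • M b a) -
          (E a a + M a a))) * T := by
    rw [Finset.mul_sum, Finset.sum_mul]
    refine Finset.sum_congr rfl fun b _ => ?_
    rw [mul_smul_comm, smul_mul_assoc, mul_sub, sub_mul, hS, ← mul_assoc, mul_add T, hTE, hTM,
      ← smul_mul_assoc, ← add_mul, mul_assoc, mul_add T, hTE, hTM, ← smul_mul_assoc, ← add_mul,
      ← mul_assoc]
  -- Termwise in b: for b ≠ a the coefficient of M_{a,b} E_{b,a} is λ_a/(λ_a - λ_b) on both sides,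
  -- that of E_{a,b} M_{b,a} is λ_b/(λ_a - λ_b), and the remaining terms agree. For b = a the
  -- dynamical sum is absent and `hME` suffices.
  have key : ∑ b, M a b * E b a + ∑ b ∈ Finset.univ.filter (fun b => b ≠ a),
        (lam b / (lam a - lam b)) • ((E a b + M a b) * (E b a + M b a) - (E a a + M a a)) =
      ∑ b, (lam b / lam a) • (E a b * M b a) + ∑ b ∈ Finset.univ.filter (fun b => b ≠ a),
        (lam b / (lam a - lam b)) •
          ((E a b + (lam a / lam b) • M a b) * (E b a + (lam b / lam a) • M b a) -
            (E a a + M a a)) := by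
    rw [Finset.sum_filter, Finset.sum_filter, ← Finset.sum_add_distrib,
      ← Finset.sum_add_distrib]
    refine Finset.sum_congr rfl fun b _ => ?_
    by_cases hb : b = a
    · subst hb
      simp [hME, h0 b]
    · have h1 := sub_ne_zero.mpr (hne b hb)
      have h2 := h0 a
      have h3 := h0 b
      simp only [if_pos hb, add_mul, mul_add, smul_mul_assoc, mul_smul_comm]
      match_scalars <;> field_simp <;> ring
  rw [mul_sub, mul_sub, mul_smul_comm, hS2, hD, mul_add, mul_add, hTX, mul_smul_comm, hMa, hG,
    ← smul_mul_assoc, ← smul_mul_assoc, ← smul_mul_assoc, ← add_mul, ← add_mul, ← sub_mul,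
    ← sub_mul, ← sub_mul]
  congr 1
  rw [sub_sub, sub_sub, sub_sub, sub_right_inj]
  rw [show (w + p) • M a a + ∑ b, M a b * E b a + X + ∑ b ∈ Finset.univ.filter (fun b => b ≠ a),
      (lam b / (lam a - lam b)) • ((E a b + M a b) * (E b a + M b a) - (E a a + M a a)) =
      (∑ b, M a b * E b a + ∑ b ∈ Finset.univ.filter (fun b => b ≠ a),
      (lam b / (lam a - lam b)) • ((E a b + M a b) * (E b a + M b a) - (E a a + M a a))) +
      ((w + p) • M a a + X) by abel, key]
  module

section Commutation

variable {N n : ℕ} {Λ : Fin n → Fin N → ℂ}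

theorem L_eq (a : Fin N) (z : Fin n → ℂ) (lam : Fin N → ℂ) :
    L Λ a z lam = (1 / 2 : ℂ) • (eTot Λ a a) ^ 2 - gaudin Λ a z (List.finRange n) -
      ∑ b ∈ Finset.univ.filter (fun b => b ≠ a),
        (lam b / (lam a - lam b)) • (eTot Λ a b * eTot Λ b a - eTot Λ a a) := by
  rw [L, gaudin_finRange, sub_sub ((1 / 2 : ℂ) • (eTot Λ a a) ^ 2)]

theorem RAt_commute_eTot {i j : Fin n} (hij : i ≠ j) {x : ℂ} (h : IsGeneric (Λ i) (Λ j) x)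
    (a b : Fin N) : Commute (RAt Λ i j x) (eTot Λ a b) := by
  have : eTot Λ a b = (eAt Λ i a b + eAt Λ j a b) +
      ∑ k ∈ (Finset.univ.erase i).erase j, eAt Λ k a b := by
    rw [eTot, add_assoc, Finset.add_sum_erase _ (fun k => eAt Λ k a b) (by simpa using hij.symm),
      Finset.add_sum_erase _ (fun k => eAt Λ k a b) (Finset.mem_univ i)]
  rw [this]
  refine (RAt_commute_add hij h a b).add_right (Commute.sum_right _ _ _ fun k hk => ?_)
  simp only [Finset.mem_erase] at hk
  exact RAt_commute_eAt hij hk.2.1 hk.1 x a b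

theorem commute_list_prod {M : Type*} [Monoid M] {x : M} {l : List M}
    (h : ∀ y ∈ l, Commute y x) : Commute l.prod x := by
  induction l with
  | nil => exact Commute.one_left x
  | cons y l ih =>
    rw [List.prod_cons]
    exact (h y (by simp)).mul_left (ih fun k hk => h k (List.mem_cons_of_mem _ hk))

theorem isUnit_list_prod {M : Type*} [Monoid M] {l : List M} (h : ∀ y ∈ l, IsUnit y) :
    IsUnit l.prod := by
  induction l with
  | nil => exact isUnit_one
  | cons y l ih =>
    rw [List.prod_cons]
    exact (h y (by simp)).mul (ih fun k hk => h k (List.mem_cons_of_mem _ hk))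

/-- An operator which commutes with the total action of `gl_N` and reorders the Gaudin-type part of
`L_a` intertwines the corresponding versions of `L_a`. -/
theorem mul_L_of_commute {P : Module.End ℂ (Tens Λ)} (hP : ∀ b c, Commute P (eTot Λ b c))
    {a : Fin N} {z : Fin n → ℂ} (lam : Fin N → ℂ) {G : Module.End ℂ (Tens Λ)}
    (hG : P * gaudin Λ a z (List.finRange n) = G * P) :
    P * L Λ a z lam = ((1 / 2 : ℂ) • (eTot Λ a a) ^ 2 - G -
      ∑ b ∈ Finset.univ.filter (fun b => b ≠ a),
        (lam b / (lam a - lam b)) • (eTot Λ a b * eTot Λ b a - eTot Λ a a)) * P := by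
  have hD : Commute P (∑ b ∈ Finset.univ.filter (fun b => b ≠ a),
        (lam b / (lam a - lam b)) • (eTot Λ a b * eTot Λ b a - eTot Λ a a)) :=
    Commute.sum_right _ _ _ fun b _ =>
      (((hP a b).mul_right (hP b a)).sub_right (hP a a)).smul_right _
  have h2 : Commute P ((1 / 2 : ℂ) • (eTot Λ a a) ^ 2) := ((hP a a).pow_right 2).smul_right _
  rw [L_eq, mul_sub, mul_sub, sub_mul, sub_mul, hG, hD.eq, h2.eq]

/-! ### The three parts of `K` and their effect on `L`. -/

variable {p : ℂ} {m : Fin n} {z : Fin n → ℂ}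

theorem isUnit_RLeft (hleft : ∀ l, l < m → IsGeneric (Λ l) (Λ m) (z l - z m - p)) :
    IsUnit (RLeft Λ p m z) := by
  refine isUnit_list_prod fun y hy => ?_
  simp only [List.mem_map, List.mem_filter, List.mem_finRange, true_and, decide_eq_true_eq] at hy
  obtain ⟨l, hl, rfl⟩ := hy
  exact isUnit_RAt hl.ne (hleft l hl)

theorem isUnit_RRight (hright : ∀ l, m < l → IsGeneric (Λ m) (Λ l) (z m - z l)) :
    IsUnit (RRight Λ m z) := by
  refine isUnit_list_prod fun y hy => ?_
  simp only [List.mem_map, List.mem_filter, List.mem_reverse, List.mem_finRange, true_and,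
    decide_eq_true_eq] at hy
  obtain ⟨l, hl, rfl⟩ := hy
  exact isUnit_RAt hl.ne (hright l hl)

theorem RLeft_commute_eTot (hleft : ∀ l, l < m → IsGeneric (Λ l) (Λ m) (z l - z m - p))
    (a b : Fin N) : Commute (RLeft Λ p m z) (eTot Λ a b) := by
  refine commute_list_prod fun y hy => ?_
  simp only [List.mem_map, List.mem_filter, List.mem_finRange, true_and, decide_eq_true_eq] at hy
  obtain ⟨l, hl, rfl⟩ := hy
  exact RAt_commute_eTot hl.ne (hleft l hl) a b

theorem RRight_commute_eTot (hright : ∀ l, m < l → IsGeneric (Λ m) (Λ l) (z m - z l))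
    (a b : Fin N) : Commute (RRight Λ m z) (eTot Λ a b) := by
  refine commute_list_prod fun y hy => ?_
  simp only [List.mem_map, List.mem_filter, List.mem_reverse, List.mem_finRange, true_and,
    decide_eq_true_eq] at hy
  obtain ⟨l, hl, rfl⟩ := hy
  exact RAt_commute_eTot hl.ne (hright l hl) a b

/-- The factors other than `m` in increasing order. -/
def others (m : Fin n) : List (Fin n) :=
  (List.finRange n).filter (fun l => l < m) ++ (List.finRange n).filter (fun l => m < l)

theorem ne_of_mem_others {k : Fin n} (h : k ∈ others m) : k ≠ m := by
  simp only [others, List.mem_append, List.mem_filter, List.mem_finRange, true_and,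
    decide_eq_true_eq] at h
  rcases h with h | h
  exacts [h.ne, h.ne']

theorem eTot_eq (m : Fin n) (a b : Fin N) :
    eTot Λ a b = eList Λ (others m) a b + eAt Λ m a b := by
  rw [← eList_finRange, finRange_eq_append m, others, eList_append, eList_append, eList_cons]
  abel

/-- The argument z_l - z_m - p is the difference of coordinates l and m of the shifted point, so
this product moves m to the front there. The coordinates of the other factors are unaffected by the
shift. -/
theorem RLeft_mul_gaudin (hleft : ∀ l, l < m → IsGeneric (Λ l) (Λ m) (z l - z m - p))
    (a : Fin N) :
    RLeft Λ p m z * gaudin Λ a (Function.update z m (z m + p)) (List.finRange n) =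
      ((z m + p) • eAt Λ m a a + ∑ b, eAt Λ m a b * eList Λ (others m) b a +
        gaudin Λ a z (others m)) * RLeft Λ p m z := by
  set z' := Function.update z m (z m + p) with hz'
  have hz : ∀ l, l < m → z' l - z' m = z l - z m - p := by
    intro l hl
    rw [hz', Function.update_of_ne hl.ne, Function.update_self, sub_sub]
  have h := prod_RAt_mul_gaudin_left (Λ := Λ) (m := m) a z'
    ((List.finRange n).filter (fun l => m < l)) ((List.finRange n).filter (fun l => l < m)) []
    (by rw [List.nil_append, ← finRange_eq_append]; exact List.nodup_finRange n)
    (fun l hl => by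
      have hl : l < m := by simpa using hl
      rw [hz l hl]
      exact hleft l hl)
  have hR : ((List.finRange n).filter (fun l => l < m)).map (fun j => RAt Λ j m (z' j - z' m)) =
      ((List.finRange n).filter (fun l => l < m)).map (fun j => RAt Λ j m (z j - z m - p)) := by
    refine List.map_congr_left fun l hl => ?_
    rw [hz l (by simpa using hl)]
  rw [hR, List.nil_append, List.nil_append, ← finRange_eq_append, ← others, gaudin] at h
  rw [RLeft, h, hz', Function.update_self,
    gaudin_congr fun k hk => Function.update_of_ne (ne_of_mem_others hk) _ _]

/-- This product works at the unshifted point and moves m to the last place. -/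
theorem RRight_mul_gaudin (hright : ∀ l, m < l → IsGeneric (Λ m) (Λ l) (z m - z l))
    (a : Fin N) :
    RRight Λ m z * gaudin Λ a z (List.finRange n) =
      (gaudin Λ a z (others m) + ∑ b, eList Λ (others m) a b * eAt Λ m b a +
        z m • eAt Λ m a a) * RRight Λ m z := by
  have h := prod_RAt_mul_gaudin_right (Λ := Λ) (m := m) a z
    ((List.finRange n).filter (fun l => m < l)) ((List.finRange n).filter (fun l => l < m))
    (by rw [← finRange_eq_append]; exact List.nodup_finRange n)
    (fun l hl => hright l (by simpa using hl))
  rw [← finRange_eq_append, ← List.append_assoc, ← others, gaudin_append,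
    ← List.filter_reverse] at h
  rw [RRight, h]
  simp [gaudin, eList_cons, eList_nil]

/-- The operator `∏_a λ_a ^ e_{a,a}` on the factor `m`. -/
def torusAt (Λ : Fin n → Fin N → ℂ) (m : Fin n) (ell : Fin N → ℂ) : Module.End ℂ (Tens Λ) :=
  site m (torus (Λ m) ell)

theorem torusAt_mul_neg (ell : Fin N → ℂ) : torusAt Λ m ell * torusAt Λ m (-ell) = 1 := by
  have := congrArg (siteHom (V := fun k => Verma (Λ k)) m) (torus_mul_torus_neg (Λ m) ell)
  rwa [map_mul, map_one] at this

theorem torusAt_neg_mul (ell : Fin N → ℂ) : torusAt Λ m (-ell) * torusAt Λ m ell = 1 := by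
  simpa using torusAt_mul_neg (Λ := Λ) (m := m) (-ell)

theorem torusAt_mul_eAt (ell : Fin N → ℂ) (a b : Fin N) :
    torusAt Λ m ell * eAt Λ m a b =
      (Complex.exp (ell a) / Complex.exp (ell b)) • (eAt Λ m a b * torusAt Λ m ell) := by
  have := congrArg (siteHom (V := fun k => Verma (Λ k)) m) (torus_mul_act (Λ m) ell a b)
  rwa [map_mul, map_smul, map_mul] at this

theorem torusAt_commute_eAt {k : Fin n} (hk : k ≠ m) (ell : Fin N → ℂ) (a b : Fin N) :
    Commute (torusAt Λ m ell) (eAt Λ k a b) :=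
  site_commute hk.symm _ _

theorem K_eq (ell : Fin N → ℂ) :
    K Λ p m z ell = Ring.inverse (RLeft Λ p m z) * torusAt Λ m ell * RRight Λ m z := rfl

theorem isUnit_K (hleft : ∀ l, l < m → IsGeneric (Λ l) (Λ m) (z l - z m - p))
    (hright : ∀ l, m < l → IsGeneric (Λ m) (Λ l) (z m - z l)) (ell : Fin N → ℂ) :
    IsUnit (K Λ p m z ell) := by
  have hT : IsUnit (torusAt Λ m ell) :=
    ⟨⟨_, _, torusAt_mul_neg ell, torusAt_neg_mul ell⟩, rfl⟩
  exact ((isUnit_RLeft hleft).ringInverse.mul hT).mul (isUnit_RRight hright)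

/-- The dependence on λ is concentrated in the middle factor, the only one to be differentiated. -/
theorem inverse_K (hleft : ∀ l, l < m → IsGeneric (Λ l) (Λ m) (z l - z m - p))
    (hright : ∀ l, m < l → IsGeneric (Λ m) (Λ l) (z m - z l)) (ell : Fin N → ℂ) :
    Ring.inverse (K Λ p m z ell) =
      Ring.inverse (RRight Λ m z) * torusAt Λ m (-ell) * RLeft Λ p m z := by
  have hA := Ring.mul_inverse_cancel _ (isUnit_RLeft hleft)
  have hB := Ring.inverse_mul_cancel _ (isUnit_RRight hright)
  have h : Ring.inverse (RRight Λ m z) * torusAt Λ m (-ell) * RLeft Λ p m z *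
      K Λ p m z ell = 1 := by
    calc _ = Ring.inverse (RRight Λ m z) * torusAt Λ m (-ell) *
          (RLeft Λ p m z * Ring.inverse (RLeft Λ p m z)) * torusAt Λ m ell * RRight Λ m z := by
          rw [K_eq]; noncomm_ring
      _ = Ring.inverse (RRight Λ m z) * (torusAt Λ m (-ell) * torusAt Λ m ell) *
          RRight Λ m z := by rw [hA]; noncomm_ring
      _ = 1 := by rw [torusAt_neg_mul, mul_one, hB]
  exact (left_inv_eq_right_inv h
    (Ring.mul_inverse_cancel _ (isUnit_K hleft hright ell))).symm

/-- Conjugation by `K_m` relates `L_a` at the shifted point to `L_a`. -/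
theorem inverse_K_mul_L (hleft : ∀ l, l < m → IsGeneric (Λ l) (Λ m) (z l - z m - p))
    (hright : ∀ l, m < l → IsGeneric (Λ m) (Λ l) (z m - z l)) {ell lam : Fin N → ℂ}
    (hell : ∀ b, Complex.exp (ell b) = lam b) {a : Fin N}
    (hne : ∀ b, b ≠ a → lam a ≠ lam b) :
    Ring.inverse (K Λ p m z ell) * L Λ a (Function.update z m (z m + p)) lam =
      L Λ a z lam * Ring.inverse (K Λ p m z ell) -
        p • (Ring.inverse (RRight Λ m z) * (eAt Λ m a a * torusAt Λ m (-ell)) *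
          RLeft Λ p m z) := by
  have h0 : ∀ b, lam b ≠ 0 := fun b => hell b ▸ Complex.exp_ne_zero _
  have hA := mul_L_of_commute (RLeft_commute_eTot hleft) lam (RLeft_mul_gaudin hleft a)
  have hB := mul_L_of_commute (RRight_commute_eTot hright) lam (RRight_mul_gaudin hright a)
  -- The total generators split into the factor m and the sum E over the other factors; X is the
  -- part of the Gaudin-type sum not involving m.
  have hT := dynamical_conj (fun b c => eAt Λ m b c) (fun b c => eList Λ (others m) b c)
    (torusAt Λ m ell) (gaudin Λ a z (others m)) lam a h0 hne
    (fun b c => by rw [torusAt_mul_eAt, hell, hell])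
    (fun b c => commute_eList fun k hk => torusAt_commute_eAt (ne_of_mem_others hk) ell b c)
    (commute_gaudin fun k hk b c => torusAt_commute_eAt (ne_of_mem_others hk) ell b c)
    (commute_eList fun k hk => eAt_commute (ne_of_mem_others hk).symm a a a a) (z m) p
  simp only [← eTot_eq] at hT
  set L₁ := (1 / 2 : ℂ) • (eTot Λ a a) ^ 2 - ((z m + p) • eAt Λ m a a +
    ∑ b, eAt Λ m a b * eList Λ (others m) b a + gaudin Λ a z (others m)) -
      ∑ b ∈ Finset.univ.filter (fun b => b ≠ a),
        (lam b / (lam a - lam b)) • (eTot Λ a b * eTot Λ b a - eTot Λ a a)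
  set L₂ := (1 / 2 : ℂ) • (eTot Λ a a) ^ 2 - (gaudin Λ a z (others m) +
    ∑ b, eList Λ (others m) a b * eAt Λ m b a + z m • eAt Λ m a a) -
      ∑ b ∈ Finset.univ.filter (fun b => b ≠ a),
        (lam b / (lam a - lam b)) • (eTot Λ a b * eTot Λ b a - eTot Λ a a)
  have hB2 : Ring.inverse (RRight Λ m z) * L₂ = L Λ a z lam * Ring.inverse (RRight Λ m z) := by
    have hu := isUnit_RRight hright
    calc _ = Ring.inverse (RRight Λ m z) * (L₂ * RRight Λ m z) *
          Ring.inverse (RRight Λ m z) := by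
          rw [mul_assoc, mul_assoc, Ring.mul_inverse_cancel _ hu, mul_one]
      _ = _ := by
          rw [← hB, ← mul_assoc, Ring.inverse_mul_cancel _ hu, one_mul]
  -- `hT` multiplied by the inverse torus on both sides. In `L₁` the factor m stands first, with z_m
  -- shifted; in `L₂` it stands last.
  have hT2 : torusAt Λ m (-ell) * L₁ =
      L₂ * torusAt Λ m (-ell) - p • (eAt Λ m a a * torusAt Λ m (-ell)) := by
    have hc : torusAt Λ m (-ell) * eAt Λ m a a = eAt Λ m a a * torusAt Λ m (-ell) := by
      rw [torusAt_mul_eAt, div_self (Complex.exp_ne_zero _), one_smul]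
    calc _ = torusAt Λ m (-ell) * (L₁ * torusAt Λ m ell) * torusAt Λ m (-ell) := by
          rw [mul_assoc, mul_assoc, torusAt_mul_neg, mul_one]
      _ = _ := by
          rw [hT, mul_sub, sub_mul, ← mul_assoc, torusAt_neg_mul, one_mul, mul_smul_comm,
            smul_mul_assoc, mul_assoc (torusAt Λ m (-ell)), mul_assoc (eAt Λ m a a),
            torusAt_mul_neg, mul_one, hc]
  rw [inverse_K hleft hright, mul_assoc, hA, ← mul_assoc, mul_assoc (Ring.inverse _), hT2,
    mul_sub, ← mul_assoc, hB2, sub_mul, mul_smul_comm, smul_mul_assoc]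
  simp only [mul_assoc]

end Commutation

/-! ### Derivatives of vector-valued functions -/

section Derivative

variable {V : Type} [AddCommGroup V] [Module ℂ V]

theorem HasVecDerivAt.map {V' : Type} [AddCommGroup V'] [Module ℂ V'] {g : ℂ → V} {v : V} {t : ℂ}
    (h : HasVecDerivAt g v t) (A : V →ₗ[ℂ] V') : HasVecDerivAt (fun s => A (g s)) (A v) t := by
  obtain ⟨⟨W, hW, hg⟩, hd⟩ := h
  refine ⟨⟨W.map A, inferInstance, hg.mono fun s hs => Submodule.mem_map_of_mem hs⟩, fun φ => ?_⟩
  exact hd (φ ∘ₗ A)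

theorem HasVecDerivAt.unique {g : ℂ → V} {v w : V} {t : ℂ} (hv : HasVecDerivAt g v t)
    (hw : HasVecDerivAt g w t) : v = w := by
  rw [← sub_eq_zero, ← Module.forall_dual_apply_eq_zero_iff ℂ]
  intro φ
  rw [map_sub, (hv.2 φ).unique (hw.2 φ), sub_self]

theorem HasPartialAt.partialDeriv_eq {N : ℕ} {a : Fin N} {f : (Fin N → ℂ) → V} {v : V}
    {lam : Fin N → ℂ} (h : HasPartialAt a f v lam) : partialDeriv a f lam = v := by
  have hex : ∃ v, HasPartialAt a f v lam := ⟨v, h⟩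
  rw [partialDeriv, dif_pos hex]
  exact HasVecDerivAt.unique hex.choose_spec h

/-- Only finitely many coordinates occur in a finite-dimensional subspace. -/
theorem exists_finset_coord_eq_zero {ι : Type*} (B : Module.Basis ι ℂ V) (W : Submodule ℂ V)
    [FiniteDimensional ℂ W] : ∃ F : Finset ι, ∀ w ∈ W, ∀ k ∉ F, B.coord k w = 0 := by
  classical
  obtain ⟨S, hS⟩ := (Submodule.fg_iff_finiteDimensional W).mpr inferInstance
  refine ⟨S.biUnion fun w => (B.repr w).support, fun w hw k hk => ?_⟩
  have : W ≤ LinearMap.ker (B.coord k) := by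
    rw [← hS]
    refine Submodule.span_le.mpr fun x hx => ?_
    simp only [Finset.mem_biUnion, not_exists, not_and, Finsupp.mem_support_iff, not_not] at hk
    exact hk x hx
  exact this hw

theorem eq_sum_coord {ι : Type*} (B : Module.Basis ι ℂ V) {F : Finset ι} {w : V}
    (h : ∀ k ∉ F, B.coord k w = 0) : w = ∑ k ∈ F, B.coord k w • B k := by
  conv_lhs => rw [← B.linearCombination_repr w, Finsupp.linearCombination_apply]
  refine Finsupp.sum_of_support_subset _ (fun k hk => ?_) _ (by simp)
  by_contra hkF
  exact (Finsupp.mem_support_iff.mp hk) (h k hkF)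

/-- The product rule for a family of operators which are diagonal in a fixed basis. -/
theorem HasVecDerivAt.diagonal {ι : Type*} (B : Module.Basis ι ℂ V) {c : ℂ → ι → ℂ} {c' : ι → ℂ}
    {A : ℂ → Module.End ℂ V} {A' : Module.End ℂ V} {g : ℂ → V} {v : V} {t : ℂ}
    (hA : ∀ s k, A s (B k) = c s k • B k) (hA' : ∀ k, A' (B k) = c' k • B k)
    (hc : ∀ k, HasDerivAt (fun s => c s k) (c' k) t) (hg : HasVecDerivAt g v t) :
    HasVecDerivAt (fun s => A s (g s)) (A' (g t) + A t v) t := by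
  obtain ⟨⟨W, hW, hgW⟩, hd⟩ := hg
  obtain ⟨F, hF⟩ := exists_finset_coord_eq_zero B W
  have hgt : ∀ k ∉ F, B.coord k (g t) = 0 := hF _ hgW.self_of_nhds
  -- Coordinates are linear functionals. Those outside F vanish along g near t, so they vanish on
  -- its derivative, and the product rule becomes a finite sum of scalar ones.
  have hv : ∀ k ∉ F, B.coord k v = 0 := fun k hk => by
    refine (hd (B.coord k)).unique ((hasDerivAt_const t (0 : ℂ)).congr_of_eventuallyEq ?_)
    exact hgW.mono fun s hs => hF _ hs k hk
  have hexp : ∀ s, (∀ k ∉ F, B.coord k (g s) = 0) →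
      A s (g s) = ∑ k ∈ F, (B.coord k (g s) * c s k) • B k := by
    intro s hs
    conv_lhs => rw [eq_sum_coord B hs]
    simp only [map_sum, map_smul, hA, smul_smul]
  refine ⟨⟨Submodule.span ℂ (B '' F), FiniteDimensional.span_of_finite ℂ (F.finite_toSet.image B),
    hgW.mono fun s hs => ?_⟩, fun φ => ?_⟩
  · show A s (g s) ∈ _
    rw [hexp s (hF _ hs)]
    exact Submodule.sum_mem _ fun k hk =>
      Submodule.smul_mem _ _ (Submodule.subset_span ⟨k, hk, rfl⟩)
  · have h1 : HasDerivAt (fun s => ∑ k ∈ F, (B.coord k (g s) * c s k) * φ (B k))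
        (∑ k ∈ F, (B.coord k v * c t k + B.coord k (g t) * c' k) * φ (B k)) t :=
      HasDerivAt.fun_sum fun k _ => ((hd (B.coord k)).mul (hc k)).mul_const _
    have h2 : φ (A' (g t) + A t v) =
        ∑ k ∈ F, (B.coord k v * c t k + B.coord k (g t) * c' k) * φ (B k) := by
      have e1 := congrArg A' (eq_sum_coord B hgt)
      have e2 := congrArg (A t) (eq_sum_coord B hv)
      simp only [map_sum, map_smul, hA, hA'] at e1 e2
      rw [e1, e2, ← Finset.sum_add_distrib, map_sum]
      refine Finset.sum_congr rfl fun k _ => ?_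
      simp only [map_add, map_smul, smul_eq_mul]
      ring
    rw [h2]
    refine h1.congr_of_eventuallyEq (hgW.mono fun s hs => ?_)
    simp only [hexp s (hF _ hs), map_sum, map_smul, smul_eq_mul]

/-- A continuous logarithm of a differentiable function is differentiable. -/
theorem hasDerivAt_of_exp_eq {g h : ℂ → ℂ} {h' t : ℂ} (hg : ContinuousAt g t)
    (hh : HasDerivAt h h' t) (hgh : ∀ᶠ s in 𝓝 t, Complex.exp (g s) = h s) :
    HasDerivAt g (h' / h t) t := by
  have ht : h t ≠ 0 := hgh.self_of_nhds ▸ Complex.exp_ne_zero _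
  -- The quotient h(s)/h(t) is near 1, where the principal logarithm is differentiable. Continuity
  -- of g keeps the imaginary part of g(s) - g(t) within (-π, π), so g agrees with this function
  -- near t.
  have h1 : HasDerivAt (fun s => g t + Complex.log (h s / h t)) (h' / h t) t := by
    have := ((hh.div_const (h t)).clog (by simp [ht])).const_add (g t)
    simpa [ht] using this
  refine h1.congr_of_eventuallyEq ?_
  have him : ∀ᶠ s in 𝓝 t, |(g s - g t).im| < Real.pi := by
    have hc : ContinuousAt (fun s => |(g s - g t).im|) t :=
      (Complex.continuous_im.continuousAt.comp (hg.sub continuousAt_const)).abs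
    exact hc.eventually_lt continuousAt_const (by simpa using Real.pi_pos)
  filter_upwards [hgh, him] with s hs hi
  rw [← hs, ← hgh.self_of_nhds, ← Complex.exp_sub,
    Complex.log_exp (abs_lt.mp hi).1 (abs_lt.mp hi).2.le]
  ring

end Derivative

/-! ### Partial derivatives of the branches of the logarithms. -/

section Branches

variable {N : ℕ}

theorem hasDerivAt_branch {O : Set (Fin N → ℂ)} (hO : IsOpen O)
    {ell : (Fin N → ℂ) → Fin N → ℂ} (hcont : ContinuousOn ell O)
    (hell : ∀ lam ∈ O, ∀ a, Complex.exp (ell lam a) = lam a) {lam : Fin N → ℂ} (hlam : lam ∈ O)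
    (a b : Fin N) :
    HasDerivAt (fun s => ell (Function.update lam a s) b) ((Pi.single a 1 : Fin N → ℂ) b / lam b)
      (lam a) := by
  have hu : Continuous fun s : ℂ => Function.update lam a s :=
    continuous_const.update a continuous_id
  have hmem : ∀ᶠ s in 𝓝 (lam a), Function.update lam a s ∈ O :=
    hu.continuousAt.eventually_mem (by simpa using hO.mem_nhds hlam)
  have hc : ContinuousAt (fun s => ell (Function.update lam a s) b) (lam a) := by
    have h1 : ContinuousAt ell (Function.update lam a (lam a)) := by
      simpa using hcont.continuousAt (hO.mem_nhds hlam)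
    exact (continuous_apply b).continuousAt.comp
      (ContinuousAt.comp (f := fun s : ℂ => Function.update lam a s) h1 hu.continuousAt)
  have hd : HasDerivAt (fun s : ℂ => Function.update lam a s b)
      ((Pi.single a 1 : Fin N → ℂ) b) (lam a) := hasDerivAt_pi.mp (hasDerivAt_update lam a _) b
  simpa using hasDerivAt_of_exp_eq hc hd (hmem.mono fun s hs => hell _ hs b)

end Branches

/-! ### The theorem -/

section Main

variable {N n : ℕ} {Λ : Fin n → Fin N → ℂ}

/-- `V_1 ⊗ … ⊗ V_n` has a basis of weight vectors with respect to the factor `m`. -/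
theorem exists_weight_basis (Λ : Fin n → Fin N → ℂ) (m : Fin n) :
    ∃ (ι : Type) (B : Module.Basis ι ℂ (Tens Λ)) (μ : ι → Fin N → ℂ), ∀ k,
      (∀ a, eAt Λ m a a (B k) = μ k a • B k) ∧
      ∀ ell, torusAt Λ m ell (B k) = Complex.exp (∑ a, ell a * μ k a) • B k := by
  set S : Set (Tens Λ) := {t | ∃ μ : Fin N → ℂ, (∀ a, eAt Λ m a a t = μ a • t) ∧
    ∀ ell, torusAt Λ m ell t = Complex.exp (∑ a, ell a * μ a) • t} with hS
  have hspan : Submodule.span ℂ S = ⊤ := by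
    rw [eq_top_iff, ← PiTensorProduct.span_tprod_eq_top, Submodule.span_le]
    rintro _ ⟨v, rfl⟩
    let φ : Verma (Λ m) →ₗ[ℂ] Tens Λ := (PiTensorProduct.tprod ℂ).toLinearMap v m
    -- With the other entries of a pure tensor fixed, it is linear in the entry m, which may
    -- therefore be taken to be a weight vector.
    have hφ : Submodule.span ℂ {w | ∃ μ, IsWeight (Λ m) μ w} ≤ (Submodule.span ℂ S).comap φ := by
      refine Submodule.span_le.mpr ?_
      rintro w ⟨μ, hw⟩
      refine Submodule.subset_span ⟨μ, fun a => ?_, fun ell => ?_⟩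
      · simp [φ, eAt, site_tprod, hw a]
      · simp [φ, torusAt, site_tprod, torus_apply hw]
    rw [span_weight] at hφ
    have := hφ (show v m ∈ (⊤ : Submodule ℂ (Verma (Λ m))) from trivial)
    simpa [φ] using this
  have hB : ∀ k, Module.Basis.ofSpan hspan.ge k ∈ S :=
    fun k => Module.Basis.ofSpan_subset hspan.ge ⟨k, rfl⟩
  choose μ hμ using hB
  exact ⟨_, Module.Basis.ofSpan hspan.ge, μ, hμ⟩

/-- The weight basis does not depend on s, so only the exponential eigenvalues are differentiated.
The resulting factor ∑ ell'_b μ_b is the eigenvalue of ∑ ell'_b e_{b,b}^{(m)}. -/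
theorem hasVecDerivAt_torusAt (m : Fin n) {ell : ℂ → Fin N → ℂ} {ell' : Fin N → ℂ}
    {g : ℂ → Tens Λ} {v : Tens Λ} {t : ℂ} (hell : ∀ b, HasDerivAt (fun s => ell s b) (ell' b) t)
    (hg : HasVecDerivAt g v t) :
    HasVecDerivAt (fun s => torusAt Λ m (ell s) (g s))
      ((∑ b, ell' b • (eAt Λ m b b * torusAt Λ m (ell t))) (g t) + torusAt Λ m (ell t) v) t := by
  obtain ⟨ι, B, μ, hB⟩ := exists_weight_basis Λ m
  refine HasVecDerivAt.diagonal B (c := fun s k => Complex.exp (∑ b, ell s b * μ k b))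
    (c' := fun k => Complex.exp (∑ b, ell t b * μ k b) * ∑ b, ell' b * μ k b)
    (fun s k => (hB k).2 _) (fun k => ?_) (fun k => ?_) hg
  · simp only [LinearMap.sum_apply, LinearMap.smul_apply, Module.End.mul_apply, (hB k).2, map_smul,
      (hB k).1, smul_smul, ← Finset.sum_smul, Finset.mul_sum]
    congr 1
    exact Finset.sum_congr rfl fun b _ => by ring
  · exact (HasDerivAt.fun_sum fun b _ => (hell b).mul_const _).cexp

end Main

end QKZ

end

theorem mainTheorem1 {N n : ℕ} (Λ : Fin n → Fin N → ℂ) (p : ℂ) (hp : p ≠ 0)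
    (O : Set (Fin N → ℂ)) (hO : IsOpen O)
    (ell : (Fin N → ℂ) → Fin N → ℂ) (hcont : ContinuousOn ell O)
    (hell : ∀ lam ∈ O, ∀ a, Complex.exp (ell lam a) = lam a)
    (m : Fin n) (a : Fin N)
    (z : Fin n → ℂ) (lam : Fin N → ℂ) (hlam : lam ∈ O)
    (hne : ∀ b, b ≠ a → lam a ≠ lam b)
    (hleft : ∀ l, l < m → QKZ.IsGeneric (Λ l) (Λ m) (z l - z m - p))
    (hright : ∀ l, m < l → QKZ.IsGeneric (Λ m) (Λ l) (z m - z l))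
    (f : (Fin n → ℂ) → (Fin N → ℂ) → QKZ.Tens Λ)
    (hf : ∃ v, QKZ.HasPartialAt a (f (Function.update z m (z m + p))) v lam) :
    IsUnit (QKZ.K Λ p m z (ell lam)) ∧
      (∃ v, QKZ.HasPartialAt a (QKZ.Z Λ p ell m f z) v lam) ∧
      QKZ.Z Λ p ell m (QKZ.D Λ p a f) z lam = QKZ.D Λ p a (QKZ.Z Λ p ell m f) z lam := by
  obtain ⟨v, hv⟩ := hf
  set g := f (Function.update z m (z m + p)) with hg
  set A := QKZ.RLeft Λ p m z with hA
  set B := Ring.inverse (QKZ.RRight Λ m z) with hB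
  have hK : ∀ e, Ring.inverse (QKZ.K Λ p m z e) = B * QKZ.torusAt Λ m (-e) * A :=
    QKZ.inverse_K hleft hright
  have ha : lam a ≠ 0 := hell lam hlam a ▸ Complex.exp_ne_zero _
  have hZ : QKZ.HasPartialAt a (QKZ.Z Λ p ell m f z)
      (B (-(lam a)⁻¹ • QKZ.eAt Λ m a a (QKZ.torusAt Λ m (-ell lam) (A (g lam))) +
        QKZ.torusAt Λ m (-ell lam) (A v))) lam := by
    have h := (QKZ.hasVecDerivAt_torusAt m (ell := fun s => -ell (Function.update lam a s))
      (fun b => (QKZ.hasDerivAt_branch hO hcont hell hlam a b).neg)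
      (QKZ.HasVecDerivAt.map hv A)).map B
    -- Only λ_a varies, so only the branch of log λ_a contributes.
    have hsum : ∑ b, -((Pi.single a 1 : Fin N → ℂ) b / lam b) •
        (QKZ.eAt Λ m b b * QKZ.torusAt Λ m (-ell lam)) =
        -(lam a)⁻¹ • (QKZ.eAt Λ m a a * QKZ.torusAt Λ m (-ell lam)) := by
      rw [Finset.sum_eq_single a (fun b _ hb => by simp [hb]) (by simp)]
      simp
    simp only [Function.update_eq_self, ← neg_div] at h hsum
    rw [hsum] at h
    have hfun : (fun s => QKZ.Z Λ p ell m f z (Function.update lam a s)) = fun s =>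
        B (QKZ.torusAt Λ m (-ell (Function.update lam a s)) (A (g (Function.update lam a s)))) := by
      funext s
      rw [QKZ.Z, hK]
      rfl
    rw [QKZ.HasPartialAt, hfun]
    exact h
  refine ⟨QKZ.isUnit_K hleft hright _, ⟨_, hZ⟩, ?_⟩
  have hmain := LinearMap.congr_fun
    (QKZ.inverse_K_mul_L hleft hright (hell lam hlam) hne) (g lam)
  have hKv : Ring.inverse (QKZ.K Λ p m z (ell lam)) v =
      B (QKZ.torusAt Λ m (-ell lam) (A v)) := by rw [hK]; rfl
  simp only [Module.End.mul_apply, LinearMap.sub_apply, LinearMap.smul_apply] at hmain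
  rw [QKZ.D, QKZ.Z, QKZ.D, hZ.partialDeriv_eq, hv.partialDeriv_eq]
  rw [map_add, map_smul, hKv, hmain, map_add, map_smul, smul_add, smul_smul, QKZ.Z]
  -- The factor p λ_a turns the derivative of the inverse torus into exactly the -p e_{a,a}^{(m)}
  -- term of `hmain`.
  rw [show p * lam a * -(lam a)⁻¹ = -p by field_simp]
  module
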